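/- Let $\Lambda\subset\mathbb{C}$ be a lattice (a discrete subgroup spanning $\mathbb{C}$ over $\mathbb{R}$), and let $$\sigma(z;\Lambda)=z\prod_{\omega\in\Lambda\setminus\{0\}}\Bigl(1-\frac{z}{\omega}\Bigr)\exp\Bigl(\frac{z}{\omega}+\frac{z^2}{2\omega^2}\Bigr)$$ be its Weierstrass sigma function. Let $n\ge 0$ and let $z_1,\dots,z_n\in\mathbb{C}$ be such that $z_i\notin\Lambda$ for all $i$ and $z_i+z_j\notin\Lambda$ for all $i<j$. For $\mathbf v=(v_1,\dots,v_n)\in\mathbb{Z}^n$ put $$\Omega_{\mathbf v}(z_1,\dots,z_n;\Lambda)=\frac{\sigma(v_1z_1+\cdots+v_nz_n;\Lambda)}{\prod_{i=1}^n\sigma(z_i;\Lambda)^{2v_i^2-\sum_{j=1}^n v_iv_j}\;\prod_{1\le i<j\le n}\sigma(z_i+z_j;\Lambda)^{v_iv_j}}$$ (so that $\Omega_{\mathbf 0}=0$). Then the function $W:\mathbb{Z}^n\to\mathbb{C}$, $W(\mathbf v)=\Omega_{\mathbf v}(z_1,\dots,z_n;\Lambda)$, is an elliptic net; that is, $W(\mathbf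 0)=0$ and for all $p,q,r,s\in\mathbb{Z}^n$ $$W(p+q+s)W(p-q)W(r+s)W(r)+W(q+r+s)W(q-r)W(p+s)W(p)+W(r+p+s)W(r-p)W(q+s)W(q)=0.$$ -/

import Mathlib

noncomputable section

namespace ComplexEllipticNet

/-- A map `W : A → R` from a free finitely generated abelian group to an integral domain is an
elliptic net if `W 0 = 0` and it satisfies the elliptic net recurrence. -/
def IsNet {A R : Type*} [AddCommGroup A] [Module.Free ℤ A] [Module.Finite ℤ A]
    [CommRing R] [IsDomain R] (W : A → R) : Prop :=
  W 0 = 0 ∧ ∀ p q r s : A,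
    W (p + q + s) * W (p - q) * W (r + s) * W r
      + W (q + r + s) * W (q - r) * W (p + s) * W p
      + W (r + p + s) * W (r - p) * W (q + s) * W q = 0

/-- The Weierstrass sigma function
`σ(z; Λ) = z ∏_{ω ∈ Λ, ω ≠ 0} (1 - z/ω) exp(z/ω + (z/ω)²/2)`. -/
def sigma (Λ : Submodule ℤ ℂ) (z : ℂ) : ℂ :=
  z * ∏' ω : {ω : Λ // ω ≠ 0},
    (1 - z / (ω.1 : ℂ)) * Complex.exp (z / (ω.1 : ℂ) + (z / (ω.1 : ℂ)) ^ 2 / 2)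

/-- The function `Ω_v(z; Λ)` for `v ∈ ℤⁿ` and `z ∈ ℂⁿ`. -/
def Omega (Λ : Submodule ℤ ℂ) {n : ℕ} (v : Fin n → ℤ) (z : Fin n → ℂ) : ℂ :=
  sigma Λ (∑ i, (v i : ℂ) * z i) /
    ((∏ i, sigma Λ (z i) ^ (2 * v i ^ 2 - ∑ j, v i * v j)) *
      ∏ i, ∏ j ∈ Finset.Ioi i, sigma Λ (z i + z j) ^ (v i * v j))

/-- The defining formula already gives the convention `Ω_0 = 0`. -/
theorem Omega_zero (Λ : Submodule ℤ ℂ) {n : ℕ} (z : Fin n → ℂ) :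
    Omega Λ (0 : Fin n → ℤ) z = 0 := by
  simp [Omega, sigma]

end ComplexEllipticNet

end

/-!
The net recurrence for `Ω` is the three-term identity of the Weierstrass sigma function.

* The denominator of `Ω_v` is a product of powers of fixed nonzero numbers whose exponents are
  quadratic forms in `v`. For a quadratic form `f`, the sum
  `f (p + q + s) + f (p - q) + f (r + s) + f r` is invariant under cyclic permutation of `p, q, r`,
  so the three terms of the recurrence have the same denominator (`netDenom_cycle`).
* The recurrence for the numerators (`sigma_net`) is a substitution in
  `σ(a+b) σ(a-b) σ(c+d) σ(c-d) + σ(b+c) σ(b-c) σ(a+d) σ(a-d) + σ(c+a) σ(c-a) σ(b+d) σ(b-d) = 0`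
  (`threeTerm_eq_zero`, up to sign). As a function of `d`, the left-hand side is a linear
  combination of three functions `d ↦ σ(d + x) σ(d - x)`, which all have the same factors of
  automorphy. For generic `a` it vanishes at the zeros `±a + l` of `σ(d + a) σ(d - a)`, which are
  simple. The quotient of the two is then entire and periodic, hence constant by Liouville's
  theorem, and it is `0` because the left-hand side vanishes at `d = b`. Special values of `a` and
  `b` follow by continuity.

The facts about `σ` that this uses are that it is entire and odd, with simple zeros exactly at the
lattice points, and that `σ(z + l) = C exp(η z) σ(z)` for each lattice point `l`
(`exists_sigma_add_coe`). The last one holds because the derivative of the logarithmic derivative of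
`σ` is `-℘` (`deriv_logDeriv_sigma`), which is periodic.
-/

noncomputable section

open Filter Topology

namespace ComplexEllipticNet

/-! ### Elementary factors -/

/-- The genus-two Weierstrass elementary factor `(1 - u) exp(u + u²/2)`. -/
def elemFactor (u : ℂ) : ℂ := (1 - u) * Complex.exp (u + u ^ 2 / 2)

@[simp] lemma elemFactor_zero : elemFactor 0 = 1 := by simp [elemFactor]

lemma elemFactor_ne_zero {u : ℂ} (hu : u ≠ 1) : elemFactor u ≠ 0 :=
  mul_ne_zero (sub_ne_zero.mpr hu.symm) (Complex.exp_ne_zero _)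

@[fun_prop]
lemma differentiable_elemFactor : Differentiable ℂ elemFactor := by
  unfold elemFactor; fun_prop

lemma norm_elemFactor_sub_one_le {u : ℂ} (hu : ‖u‖ ≤ 1 / 2) :
    ‖elemFactor u - 1‖ ≤ 2 * ‖u‖ ^ 3 := by
  have hu1 : ‖-u‖ < 1 := by rw [norm_neg]; linarith
  have hne : 1 + -u ≠ 0 := by
    intro h
    have : u = 1 := by linear_combination -h
    rw [this] at hu; norm_num at hu
  have h0 : 0 ≤ ‖u‖ := norm_nonneg u
  have hT : Complex.logTaylor (2 + 1) (-u) = -(u + u ^ 2 / 2) := by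
    simp [Complex.logTaylor, Finset.sum_range_succ]; ring
  have key := Complex.norm_log_sub_logTaylor_le 2 hu1
  rw [hT, sub_neg_eq_add, norm_neg] at key
  norm_num at key
  have hinv : (1 - ‖u‖)⁻¹ ≤ 2 := by
    rw [inv_le_comm₀ (by linarith) (by norm_num)]; linarith
  have hle : ‖Complex.log (1 + -u) + (u + u ^ 2 / 2)‖ ≤ ‖u‖ ^ 3 := by
    refine key.trans ?_
    nlinarith [mul_le_mul_of_nonneg_left hinv (pow_nonneg h0 3), pow_nonneg h0 3]
  -- The bound for `log` passes to `exp` because its argument has norm at most one.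
  have hE : elemFactor u = Complex.exp (Complex.log (1 + -u) + (u + u ^ 2 / 2)) := by
    rw [Complex.exp_add, Complex.exp_log hne, elemFactor, sub_eq_add_neg]
  rw [hE]
  refine (Complex.norm_exp_sub_one_le (hle.trans (pow_le_one₀ h0 (by linarith)))).trans ?_
  linarith

lemma hasDerivAt_elemFactor (u : ℂ) :
    HasDerivAt elemFactor (-u ^ 2 * Complex.exp (u + u ^ 2 / 2)) u := by
  have h := ((hasDerivAt_id' u).const_sub 1).fun_mul
    ((hasDerivAt_id' u).fun_add (((hasDerivAt_id' u).fun_pow 2).div_const 2)).cexp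
  refine h.congr_deriv ?_
  push_cast
  ring

lemma logDeriv_elemFactor_div {l z : ℂ} (hl : l ≠ 0) (hz : z ≠ l) :
    logDeriv (fun w => elemFactor (w / l)) z = 1 / (z - l) + 1 / l + z / l ^ 2 := by
  have h1 : z - l ≠ 0 := sub_ne_zero.mpr hz
  have hne : 1 - z / l ≠ 0 := by
    rw [one_sub_div hl]; exact div_ne_zero (sub_ne_zero.mpr hz.symm) hl
  have hE := Complex.exp_ne_zero (z / l + (z / l) ^ 2 / 2)
  have h : HasDerivAt (fun w => elemFactor (w / l))
      (-(z / l) ^ 2 * Complex.exp (z / l + (z / l) ^ 2 / 2) * (1 / l)) z :=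
    HasDerivAt.comp (h₂ := elemFactor) (h := fun w => w / l) z
      (hasDerivAt_elemFactor (z / l)) ((hasDerivAt_id' z).div_const l)
  rw [logDeriv_apply, h.deriv, elemFactor, mul_right_comm, mul_div_mul_right _ _ hE,
    div_eq_iff hne]
  field_simp
  ring

/-! ### The infinite product -/

variable (L : PeriodPair)

/-- The product of the elementary factors of the lattice points. The factor at `0` is `1` because
`z / 0 = 0`, so this is the sigma function divided by `z`. -/
def sigmaProd (z : ℂ) : ℂ := ∏' l : L.lattice, elemFactor (z / l)

lemma sigma_eq_mul_sigmaProd (z : ℂ) : sigma L.lattice z = z * sigmaProd L z := by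
  unfold sigma sigmaProd
  congr 1
  exact tprod_subtype_eq_of_mulSupport_subset (s := {ω : L.lattice | ω ≠ 0})
    (f := fun l : L.lattice => elemFactor (z / l)) (fun l hl h0 => hl (by simp [h0]))

lemma eventually_norm_elemFactor_sub_one_le (r : ℝ) :
    ∀ᶠ l : L.lattice in cofinite, ∀ z : ℂ, ‖z‖ ≤ r →
      ‖elemFactor (z / l) - 1‖ ≤ 2 * r ^ 3 * ‖(l : ℂ)‖ ^ (-3 : ℝ) := by
  refine (isCompact_iff_finite.mp
    (isCompact_closedBall (0 : L.lattice) (2 * r))).subset fun l hl => ?_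
  obtain ⟨z, hz, hlt⟩ : ∃ z : ℂ, ‖z‖ ≤ r ∧
      2 * r ^ 3 * ‖(l : ℂ)‖ ^ (-3 : ℝ) < ‖elemFactor (z / l) - 1‖ := by simpa using hl
  have hr : 0 ≤ r := (norm_nonneg z).trans hz
  rw [Metric.mem_closedBall, dist_zero_right]
  by_contra! hlr
  have hlr' : 2 * r < ‖(l : ℂ)‖ := hlr
  have hl0 : 0 < ‖(l : ℂ)‖ := by linarith
  refine absurd hlt (not_lt.mpr ?_)
  refine (norm_elemFactor_sub_one_le ?_).trans ?_
  · rw [norm_div, div_le_iff₀ hl0]; linarith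
  · rw [show (-3 : ℝ) = ((-3 : ℤ) : ℝ) by norm_num, Real.rpow_intCast, norm_div, div_pow,
      zpow_neg, mul_assoc, div_eq_mul_inv]
    norm_cast
    gcongr

lemma summable_lattice_norm_rpow (c : ℝ) :
    Summable fun l : L.lattice => c * ‖(l : ℂ)‖ ^ (-3 : ℝ) :=
  (ZLattice.summable_norm_rpow L.lattice _ (by simp; norm_num)).mul_left c

lemma hasProdLocallyUniformlyOn_sigmaProd :
    HasProdLocallyUniformlyOn (fun (l : L.lattice) z => elemFactor (z / l)) (sigmaProd L)
      Set.univ := by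
  refine hasProdLocallyUniformlyOn_of_forall_compact isOpen_univ fun K _ hK => ?_
  obtain ⟨r, hr⟩ := hK.isBounded.exists_norm_le
  have := Summable.hasProdUniformlyOn_one_add
    (f := fun (l : L.lattice) z => elemFactor (z / l) - 1) hK
    (summable_lattice_norm_rpow L (2 * r ^ 3))
    ((eventually_norm_elemFactor_sub_one_le L r).mono fun l h z hz => h z (hr z hz))
    (fun l => by
      apply Continuous.continuousOn
      exact (Differentiable.continuous (𝕜 := ℂ) (by fun_prop)))
  simp only [add_sub_cancel] at this
  exact this

lemma differentiable_prod_elemFactor (s : Finset L.lattice) :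
    Differentiable ℂ fun z => ∏ l ∈ s, elemFactor (z / l) := by fun_prop

lemma tendstoLocallyUniformlyOn_sigmaProd :
    TendstoLocallyUniformlyOn (fun (s : Finset L.lattice) z => ∏ l ∈ s, elemFactor (z / l))
      (sigmaProd L) atTop Set.univ :=
  hasProdLocallyUniformlyOn_sigmaProd L

@[fun_prop]
lemma differentiable_sigmaProd : Differentiable ℂ (sigmaProd L) :=
  differentiableOn_univ.mp <| (tendstoLocallyUniformlyOn_sigmaProd L).differentiableOn
    (.of_forall fun s => (differentiable_prod_elemFactor L s).differentiableOn) isOpen_univ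

@[simp] lemma sigmaProd_zero : sigmaProd L 0 = 1 := by simp [sigmaProd]

lemma elemFactor_div_ne_zero {z : ℂ} {L : PeriodPair} (hz : z ∉ L.lattice) (l : L.lattice) :
    elemFactor (z / l) ≠ 0 := by
  refine elemFactor_ne_zero fun h => hz ?_
  have hl : (l : ℂ) ≠ 0 := by rintro h0; simp [h0] at h
  rw [div_eq_one_iff_eq hl] at h
  exact h ▸ l.2

lemma sigmaProd_ne_zero {z : ℂ} (hz : z ∉ L.lattice) : sigmaProd L z ≠ 0 := by
  have := tprod_one_add_ne_zero_of_summable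
    (f := fun l : L.lattice => elemFactor (z / l) - 1) (fun l => ?_) ?_
  · simp only [add_sub_cancel] at this
    exact this
  · rw [add_sub_cancel]
    exact elemFactor_div_ne_zero hz l
  · refine (summable_lattice_norm_rpow L (2 * ‖z‖ ^ 3)).of_norm_bounded_eventually ?_
    filter_upwards [eventually_norm_elemFactor_sub_one_le L ‖z‖] with l hl
    simpa using hl z le_rfl

/-- This formula makes the second logarithmic derivative pass to pointwise limits of a function and
its first two derivatives. -/
lemma deriv_logDeriv {f : ℂ → ℂ} (hf : Differentiable ℂ f) {z : ℂ} (hz : f z ≠ 0) :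
    deriv (logDeriv f) z = (deriv (deriv f) z * f z - deriv f z * deriv f z) / f z ^ 2 := by
  have : logDeriv f = fun w => deriv f w / f w := rfl
  rw [this, deriv_fun_div (hf.deriv z) (hf z) hz]

lemma deriv_logDeriv_prod_elemFactor (s : Finset L.lattice) {z : ℂ} (hz : z ∉ L.lattice) :
    deriv (logDeriv fun w => ∏ l ∈ s, elemFactor (w / l)) z =
      -∑ l ∈ s, if (l : ℂ) = 0 then 0 else (1 / (z - l) ^ 2 - 1 / (l : ℂ) ^ 2) := by
  have hU : (L.lattice : Set ℂ)ᶜ ∈ 𝓝 z := L.isClosed_lattice.isOpen_compl.mem_nhds hz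
  have hev : (logDeriv fun w => ∏ l ∈ s, elemFactor (w / l)) =ᶠ[𝓝 z] fun w =>
      ∑ l ∈ s, if (l : ℂ) = 0 then 0 else (1 / (w - l) + 1 / (l : ℂ) + w / (l : ℂ) ^ 2) := by
    filter_upwards [hU] with w hw
    have hwl (l : L.lattice) : w ≠ l := fun h => hw (h ▸ l.2)
    rw [logDeriv_prod (f := fun (l : L.lattice) w => elemFactor (w / l))]
    · refine Finset.sum_congr rfl fun l _ => ?_
      split_ifs with h
      · simp [h, logDeriv_const]
      · exact logDeriv_elemFactor_div h (hwl l)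
    · exact fun l _ => elemFactor_div_ne_zero hw l
    · intro l _; fun_prop
  rw [hev.deriv_eq, ← Finset.sum_neg_distrib]
  refine HasDerivAt.deriv (HasDerivAt.fun_sum fun l _ => ?_)
  split_ifs with h
  · simpa using hasDerivAt_const z (0 : ℂ)
  · have hzl : z - l ≠ 0 := sub_ne_zero.mpr fun h => hz (h ▸ l.2)
    have h1 := ((hasDerivAt_id z).sub_const (l : ℂ)).fun_inv hzl
    have h2 := (hasDerivAt_id z).div_const ((l : ℂ) ^ 2)
    convert! (h1.add_const (1 / (l : ℂ))).add h2 using 1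
    · ext w; simp
    · simp; ring

/-- Locally uniform limits commute with derivatives, so the second logarithmic derivative of the
product is the sum of those of its factors, which is the series of `-℘` without its polar term. -/
lemma deriv_logDeriv_sigmaProd {z : ℂ} (hz : z ∉ L.lattice) :
    deriv (logDeriv (sigmaProd L)) z = -L.weierstrassPExcept 0 z := by
  have h0 := tendstoLocallyUniformlyOn_sigmaProd L
  have h1 := h0.deriv
    (.of_forall fun s => (differentiable_prod_elemFactor L s).differentiableOn) isOpen_univ
  have h2 := h1.deriv
    (.of_forall fun s => (differentiable_prod_elemFactor L s).deriv.differentiableOn) isOpen_univ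
  have t0 := h0.tendsto_at (Set.mem_univ z)
  have t1 := h1.tendsto_at (Set.mem_univ z)
  have t2 := h2.tendsto_at (Set.mem_univ z)
  have hP := sigmaProd_ne_zero L hz
  have t := ((t2.mul t0).sub (t1.mul t1)).div (t0.pow 2) (pow_ne_zero 2 hP)
  rw [← deriv_logDeriv (differentiable_sigmaProd L) hP] at t
  refine tendsto_nhds_unique t ?_
  have hs := L.hasSum_weierstrassPExcept 0 z
  rw [HasSum, SummationFilter.unconditional_filter] at hs
  refine hs.neg.congr fun s => ?_
  rw [← deriv_logDeriv_prod_elemFactor L s hz,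
    deriv_logDeriv (differentiable_prod_elemFactor L s)
      (Finset.prod_ne_zero_iff.mpr fun l _ => elemFactor_div_ne_zero hz l)]
  rfl

/-! ### Analytic properties of the sigma function -/

@[fun_prop]
lemma differentiable_sigma : Differentiable ℂ (sigma L.lattice) := by
  rw [show sigma L.lattice = fun z => z * sigmaProd L z from funext (sigma_eq_mul_sigmaProd L)]
  fun_prop

@[fun_prop]
lemma continuous_sigma : Continuous (sigma L.lattice) := (differentiable_sigma L).continuous

lemma sigma_ne_zero {z : ℂ} (hz : z ∉ L.lattice) : sigma L.lattice z ≠ 0 := by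
  rw [sigma_eq_mul_sigmaProd]
  exact mul_ne_zero (fun h => hz (h ▸ zero_mem _)) (sigmaProd_ne_zero L hz)

lemma deriv_sigma_zero : deriv (sigma L.lattice) 0 = 1 := by
  rw [show sigma L.lattice = fun z => z * sigmaProd L z from funext (sigma_eq_mul_sigmaProd L),
    deriv_fun_mul differentiableAt_fun_id (differentiable_sigmaProd L 0)]
  simp

lemma sigma_neg (z : ℂ) : sigma L.lattice (-z) = -sigma L.lattice z := by
  simp only [sigma_eq_mul_sigmaProd, sigmaProd]
  rw [← (Equiv.neg L.lattice).tprod_eq]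
  simp

lemma deriv_logDeriv_sigma {z : ℂ} (hz : z ∉ L.lattice) :
    deriv (logDeriv (sigma L.lattice)) z = -L.weierstrassP z := by
  have hz0 : z ≠ 0 := fun h => hz (h ▸ zero_mem _)
  have hP := sigmaProd_ne_zero L hz
  have hev : logDeriv (sigma L.lattice) =ᶠ[𝓝 z] fun w => w⁻¹ + logDeriv (sigmaProd L) w := by
    filter_upwards [L.isClosed_lattice.isOpen_compl.mem_nhds hz] with w hw
    rw [show sigma L.lattice = fun z => z * sigmaProd L z from funext (sigma_eq_mul_sigmaProd L),
      logDeriv_mul (f := fun w => w) w (fun h => hw (h ▸ zero_mem _)) (sigmaProd_ne_zero L hw)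
        differentiableAt_id (differentiable_sigmaProd L w)]
    simp [logDeriv_apply]
  have hd : DifferentiableAt ℂ (logDeriv (sigmaProd L)) z :=
    ((differentiable_sigmaProd L).deriv z).div (differentiable_sigmaProd L z) hP
  rw [hev.deriv_eq, deriv_fun_add (differentiableAt_inv hz0) hd, deriv_logDeriv_sigmaProd L hz,
    deriv_inv, ← L.weierstrassPExcept_add 0 z]
  simp

lemma countable_lattice : (L.lattice : Set ℂ).Countable :=
  have : Countable L.lattice := L.latticeEquivProd.toEquiv.countable_iff.mpr inferInstance
  Set.to_countable _

lemma isPreconnected_compl_lattice : IsPreconnected (L.lattice : Set ℂ)ᶜ :=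
  ((countable_lattice L).isConnected_compl_of_one_lt_rank (by simp)).isPreconnected

lemma dense_compl_lattice : Dense (L.lattice : Set ℂ)ᶜ := (countable_lattice L).dense_compl ℂ

lemma dense_compl_shifts (a : ℂ) :
    Dense ((((· - a) '' (L.lattice : Set ℂ)) ∪ ((· + a) '' (L.lattice : Set ℂ)))ᶜ) :=
  (((countable_lattice L).image _).union ((countable_lattice L).image _)).dense_compl ℂ

/-- The quasi-periodicity of sigma. As `℘` is periodic, `σ(z + l)` and `σ(z)` have logarithmic
derivatives that differ by a constant on the connected complement of the lattice. -/
lemma exists_sigma_add_coe {l : ℂ} (hl : l ∈ L.lattice) :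
    ∃ C η : ℂ, C ≠ 0 ∧
      ∀ z, sigma L.lattice (z + l) = C * (Complex.exp (η * z) * sigma L.lattice z) := by
  set U : Set ℂ := (L.lattice : Set ℂ)ᶜ
  have hUo : IsOpen U := L.isClosed_lattice.isOpen_compl
  have hadd {z : ℂ} (hz : z ∈ U) : z + l ∉ L.lattice := fun h =>
    hz (by simpa using sub_mem h hl)
  have hdl {z : ℂ} (hz : z ∉ L.lattice) : DifferentiableAt ℂ (logDeriv (sigma L.lattice)) z :=
    ((differentiable_sigma L).deriv z).div (differentiable_sigma L z) (sigma_ne_zero L hz)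
  have hdl' {z : ℂ} (hz : z ∈ U) :
      DifferentiableAt ℂ (fun w => logDeriv (sigma L.lattice) (w + l)) z :=
    (hdl (hadd hz)).comp z (by fun_prop)
  obtain ⟨η, hη⟩ : ∃ η, ∀ z ∈ U,
      logDeriv (sigma L.lattice) (z + l) - logDeriv (sigma L.lattice) z = η := by
    refine hUo.exists_is_const_of_deriv_eq_zero (isPreconnected_compl_lattice L)
      (fun z hz => ((hdl' hz).sub (hdl hz)).differentiableWithinAt) fun z hz => ?_
    rw [deriv_fun_sub (hdl' hz) (hdl hz), deriv_comp_add_const, deriv_logDeriv_sigma L hz,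
      deriv_logDeriv_sigma L (hadd hz), L.weierstrassP_add_coe z ⟨l, hl⟩]
    simp
  have hlog : Set.EqOn (logDeriv fun z => sigma L.lattice (z + l))
      (logDeriv fun z => Complex.exp (η * z) * sigma L.lattice z) U := fun z hz => by
    rw [logDeriv_mul (f := fun z => Complex.exp (η * z)) z (Complex.exp_ne_zero _)
      (sigma_ne_zero L hz) (by fun_prop) (by fun_prop)]
    have : deriv (fun z => Complex.exp (η * z)) z = Complex.exp (η * z) * η := by
      simpa using ((hasDerivAt_id' z).const_mul η).cexp.deriv
    rw [logDeriv_apply (f := fun z => Complex.exp (η * z)), this,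
      mul_div_cancel_left₀ _ (Complex.exp_ne_zero _), ← hη z hz, logDeriv_apply,
      deriv_comp_add_const, ← logDeriv_apply]
    ring
  rw [logDeriv_eqOn_iff (by fun_prop) (by fun_prop) hUo (isPreconnected_compl_lattice L)
    (fun z hz => mul_ne_zero (Complex.exp_ne_zero _) (sigma_ne_zero L hz))
    (fun z hz => sigma_ne_zero L (hadd hz))] at hlog
  obtain ⟨C, hC, h⟩ := hlog
  refine ⟨C, η, hC, congrFun (Continuous.ext_on (dense_compl_lattice L) (by fun_prop)
    (by fun_prop) fun z hz => ?_)⟩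
  simpa using h hz

lemma sigma_eq_zero_iff {z : ℂ} : sigma L.lattice z = 0 ↔ z ∈ L.lattice := by
  refine ⟨fun h => by_contra fun hz => sigma_ne_zero L hz h, fun hz => ?_⟩
  obtain ⟨C, η, -, h⟩ := exists_sigma_add_coe L hz
  simpa [sigma_eq_mul_sigmaProd] using h 0

lemma deriv_sigma_ne_zero {z : ℂ} (hz : z ∈ L.lattice) : deriv (sigma L.lattice) z ≠ 0 := by
  obtain ⟨C, η, hC, h⟩ := exists_sigma_add_coe L hz
  have h0 : sigma L.lattice 0 = 0 := (sigma_eq_zero_iff L).mpr (zero_mem _)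
  have h1 : deriv (fun w => sigma L.lattice (w + z)) 0 = C := by
    rw [funext h, deriv_const_mul _ (by fun_prop), deriv_fun_mul (by fun_prop) (by fun_prop),
      deriv_sigma_zero, h0]
    simp
  rw [deriv_comp_add_const, zero_add] at h1
  rwa [h1]

/-! ### Quotients of entire functions -/

/-- An entire function that vanishes at the zeros of another one, which are all simple, is an
entire multiple of it. -/
lemma exists_differentiable_mul_eq {f g : ℂ → ℂ} (hf : Differentiable ℂ f)
    (hg : Differentiable ℂ g) (hfg : ∀ z, g z = 0 → f z = 0)
    (hg' : ∀ z, g z = 0 → deriv g z ≠ 0) :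
    ∃ q : ℂ → ℂ, Differentiable ℂ q ∧ ∀ z, f z = q z * g z := by
  classical
  refine ⟨fun z => if g z = 0 then deriv f z / deriv g z else f z / g z, fun z => ?_,
    fun z => ?_⟩
  · by_cases hz : g z = 0
    · have hdf : Differentiable ℂ (dslope f z) := differentiableOn_univ.mp
        ((Complex.differentiableOn_dslope univ_mem).mpr hf.differentiableOn)
      have hdg : Differentiable ℂ (dslope g z) := differentiableOn_univ.mp
        ((Complex.differentiableOn_dslope univ_mem).mpr hg.differentiableOn)
      have hne : dslope g z z ≠ 0 := by simpa using hg' z hz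
      refine ((hdf z).fun_div (hdg z) hne).congr_of_eventuallyEq ?_
      filter_upwards [hdg.continuous.continuousAt.eventually_ne hne] with w hw
      rcases eq_or_ne w z with rfl | hwz
      · simp [hz]
      · have hwz' : w - z ≠ 0 := sub_ne_zero.mpr hwz
        rw [dslope_of_ne _ hwz, slope_def_field, hz, sub_zero] at hw
        have hgw : g w ≠ 0 := fun h => hw (by simp [h])
        rw [if_neg hgw, dslope_of_ne _ hwz, dslope_of_ne _ hwz, slope_def_field, slope_def_field,
          hz, hfg z hz, sub_zero, sub_zero, div_div_div_cancel_right₀ hwz']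
    · refine ((hf z).fun_div (hg z) hz).congr_of_eventuallyEq ?_
      filter_upwards [hg.continuous.continuousAt.eventually_ne hz] with w hw
      rw [if_neg hw]
  · by_cases hz : g z = 0
    · simp [hz, hfg z hz]
    · simp [hz]

/-- Two entire functions with the same factors of automorphy over a lattice are proportional if one
of them vanishes at the zeros of the other one, which are all simple: their quotient is entire and
periodic, hence bounded. -/
lemma exists_const_mul_eq_of_quasiperiodic (Λ : Submodule ℤ ℂ) [DiscreteTopology Λ]
    [IsZLattice ℝ Λ] {f g : ℂ → ℂ} (hf : Differentiable ℂ f) (hg : Differentiable ℂ g)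
    (hfg : ∀ z, g z = 0 → f z = 0) (hg' : ∀ z, g z = 0 → deriv g z ≠ 0)
    (hdense : Dense {z | g z ≠ 0})
    (hper : ∀ l ∈ Λ, ∃ e : ℂ → ℂ, ∀ z, e z ≠ 0 ∧ f (z + l) = e z * f z ∧ g (z + l) = e z * g z) :
    ∃ k : ℂ, ∀ z, f z = k * g z := by
  obtain ⟨q, hq, h⟩ := exists_differentiable_mul_eq hf hg hfg hg'
  have hqper (z w : ℂ) (hw : w ∈ Λ) : q (z + w) = q z := by
    obtain ⟨e, he⟩ := hper w hw
    refine congrFun (Continuous.ext_on (f := fun z => q (z + w)) hdense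
      (hq.continuous.comp (by fun_prop)) hq.continuous fun z hz => ?_) z
    obtain ⟨h0, h1, h2⟩ := he z
    rw [h, h2, h z] at h1
    exact mul_right_cancel₀ (mul_ne_zero h0 hz) (by linear_combination h1)
  have hb := (IsZLattice.isCompact_range_of_periodic Λ q hq.continuous hqper).isBounded
  exact ⟨q 0, fun z => by rw [h z, hq.apply_eq_apply_of_bounded hb z 0]⟩

/-! ### The three-term identity -/

/-- The function `d ↦ σ(d + c) σ(d - c)`, whose factors of automorphy do not depend on `c`. -/
def sigmaPair (c d : ℂ) : ℂ := sigma L.lattice (d + c) * sigma L.lattice (d - c)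

lemma exists_sigmaPair_add_coe {l : ℂ} (hl : l ∈ L.lattice) :
    ∃ e : ℂ → ℂ, ∀ d, e d ≠ 0 ∧ ∀ c, sigmaPair L c (d + l) = e d * sigmaPair L c d := by
  obtain ⟨C, η, hC, h⟩ := exists_sigma_add_coe L hl
  refine ⟨fun d => C ^ 2 * (Complex.exp (η * d) * Complex.exp (η * d)), fun d =>
    ⟨by simp [hC], fun c => ?_⟩⟩
  have hexp : Complex.exp (η * (d + c)) * Complex.exp (η * (d - c)) =
      Complex.exp (η * d) * Complex.exp (η * d) := by
    rw [← Complex.exp_add, ← Complex.exp_add]; ring_nf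
  rw [sigmaPair, sigmaPair, add_right_comm, add_sub_right_comm, h, h]
  linear_combination C ^ 2 * sigma L.lattice (d + c) * sigma L.lattice (d - c) * hexp

lemma deriv_sigmaPair_ne_zero {a d : ℂ} (ha : a + a ∉ L.lattice) (h : sigmaPair L a d = 0) :
    deriv (sigmaPair L a) d ≠ 0 := by
  have hder : deriv (sigmaPair L a) d = deriv (sigma L.lattice) (d + a) * sigma L.lattice (d - a)
      + sigma L.lattice (d + a) * deriv (sigma L.lattice) (d - a) := by
    unfold sigmaPair
    rw [deriv_fun_mul (by fun_prop) (by fun_prop), deriv_comp_add_const, deriv_comp_sub_const]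
  rw [hder]
  rcases mul_eq_zero.mp h with h1 | h1
  · have h1' := (sigma_eq_zero_iff L).mp h1
    rw [h1, zero_mul, add_zero]
    refine mul_ne_zero (deriv_sigma_ne_zero L h1') (sigma_ne_zero L fun h2 => ha ?_)
    simpa using sub_mem h1' h2
  · have h1' := (sigma_eq_zero_iff L).mp h1
    rw [h1, mul_zero, zero_add]
    refine mul_ne_zero (sigma_ne_zero L fun h2 => ha ?_) (deriv_sigma_ne_zero L h1')
    simpa using sub_mem h2 h1'

/-- The sum of three products in the three-term identity of the sigma function, with `σ(c - d)`,
`σ(a - d)` and `σ(b - d)` replaced by their negatives. This exhibits it as a combination of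
functions of `d` with the same factors of automorphy. -/
def threeTerm (a b c d : ℂ) : ℂ :=
  sigmaPair L b a * sigmaPair L c d + sigmaPair L c b * sigmaPair L a d
    + sigmaPair L a c * sigmaPair L b d

lemma sigmaPair_swap (a b : ℂ) : sigmaPair L a b = -sigmaPair L b a := by
  rw [sigmaPair, sigmaPair, ← neg_sub a b, sigma_neg, add_comm b a]; ring

@[simp] lemma sigmaPair_self (a : ℂ) : sigmaPair L a a = 0 := by
  simp [sigmaPair, sigma_eq_mul_sigmaProd]

lemma sigmaPair_neg (a b : ℂ) : sigmaPair L a (-b) = sigmaPair L a b := by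
  rw [sigmaPair, sigmaPair, show -b + a = -(b - a) by ring, show -b - a = -(b + a) by ring,
    sigma_neg, sigma_neg]
  ring

@[fun_prop]
lemma differentiable_sigmaPair (c : ℂ) : Differentiable ℂ (sigmaPair L c) := by
  unfold sigmaPair; fun_prop

/-- The three-term identity for `a`, `b` in general position. As functions of `d`, the left-hand
side is a multiple of `σ(d + a) σ(d - a)`, and it vanishes at `d = b`. -/
lemma threeTerm_eq_zero_of_notMem {a b : ℂ} (ha : a + a ∉ L.lattice) (hab : b + a ∉ L.lattice)
    (hab' : b - a ∉ L.lattice) (c d : ℂ) : threeTerm L a b c d = 0 := by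
  have hself : threeTerm L a b c a = 0 := by
    simp only [threeTerm, sigmaPair_self, sigmaPair_swap L c a]; ring
  have htrans {x l : ℂ} (hl : l ∈ L.lattice) (hx : threeTerm L a b c x = 0) :
      threeTerm L a b c (x + l) = 0 := by
    obtain ⟨e, he⟩ := exists_sigmaPair_add_coe L hl
    unfold threeTerm at hx ⊢
    simp only [(he x).2]
    linear_combination e x * hx
  -- The zeros of `sigmaPair L a` are the translates of `a` and `-a` by the lattice.
  have hzero (d : ℂ) (hd : sigmaPair L a d = 0) : threeTerm L a b c d = 0 := by
    rcases mul_eq_zero.mp hd with h | h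
    · have := htrans (x := -a) ((sigma_eq_zero_iff L).mp h)
        (by simpa only [threeTerm, sigmaPair_neg] using hself)
      rwa [show -a + (d + a) = d by ring] at this
    · have := htrans ((sigma_eq_zero_iff L).mp h) hself
      rwa [add_sub_cancel] at this
  have hdense : Dense {d | sigmaPair L a d ≠ 0} := by
    refine Dense.mono (fun d hd => ?_) (dense_compl_shifts L a)
    refine fun h => hd ?_
    rcases mul_eq_zero.mp h with h | h
    · exact Or.inl ⟨_, (sigma_eq_zero_iff L).mp h, by simp⟩
    · exact Or.inr ⟨_, (sigma_eq_zero_iff L).mp h, by simp⟩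
  obtain ⟨k, hk⟩ := exists_const_mul_eq_of_quasiperiodic L.lattice
    (f := threeTerm L a b c) (g := sigmaPair L a) (by unfold threeTerm; fun_prop) (by fun_prop)
    hzero (fun d => deriv_sigmaPair_ne_zero L ha) hdense fun l hl => by
      obtain ⟨e, he⟩ := exists_sigmaPair_add_coe L hl
      refine ⟨e, fun z => ⟨(he z).1, ?_, (he z).2 a⟩⟩
      simp only [threeTerm, (he z).2]
      ring
  have hb : threeTerm L a b c b = 0 := by
    simp only [threeTerm, sigmaPair_self, sigmaPair_swap L a b]; ring
  rw [hk b] at hb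
  have hne : sigmaPair L a b ≠ 0 := mul_ne_zero (sigma_ne_zero L hab) (sigma_ne_zero L hab')
  rw [hk d, (mul_eq_zero.mp hb).resolve_right hne, zero_mul]

/-- The three-term identity of the sigma function, which extends by continuity to all `a`, `b`. -/
theorem threeTerm_eq_zero (a b c d : ℂ) : threeTerm L a b c d = 0 := by
  have hb (a : ℂ) (ha : a + a ∉ L.lattice) (b : ℂ) : threeTerm L a b c d = 0 := by
    refine congrFun (Continuous.ext_on (f := fun b => threeTerm L a b c d) (g := fun _ => 0)
      (dense_compl_shifts L a) (by unfold threeTerm sigmaPair; fun_prop) continuous_const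
      fun b hb => ?_) b
    exact threeTerm_eq_zero_of_notMem L ha (fun h => hb (Or.inl ⟨_, h, by simp⟩))
      (fun h => hb (Or.inr ⟨_, h, by simp⟩)) c d
  have hdense : Dense (((· / 2) '' (L.lattice : Set ℂ))ᶜ) :=
    Set.Countable.dense_compl ℂ ((countable_lattice L).image _)
  refine congrFun (Continuous.ext_on (f := fun a => threeTerm L a b c d) (g := fun _ => 0) hdense
    (by unfold threeTerm sigmaPair; fun_prop) continuous_const fun a ha => ?_) a
  exact hb a (fun h => ha ⟨_, h, by simp⟩) b

/-- The elliptic net recurrence for the sigma function itself. -/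
theorem sigma_net (p q r s : ℂ) :
    sigma L.lattice (p + q + s) * sigma L.lattice (p - q) * sigma L.lattice (r + s)
        * sigma L.lattice r
      + sigma L.lattice (q + r + s) * sigma L.lattice (q - r) * sigma L.lattice (p + s)
        * sigma L.lattice p
      + sigma L.lattice (r + p + s) * sigma L.lattice (r - p) * sigma L.lattice (q + s)
        * sigma L.lattice q = 0 := by
  -- Shifting `p`, `q`, `r` by `s / 2` turns `p + q + s` and `p - q` into a sum and a difference.
  have h := threeTerm_eq_zero L (p + s / 2) (q + s / 2) (r + s / 2) (s / 2)
  have e (x y : ℂ) : sigmaPair L (x + s / 2) (y + s / 2)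
      = sigma L.lattice (y + x + s) * sigma L.lattice (y - x) := by
    rw [sigmaPair]; congr 2 <;> ring
  have e' (x : ℂ) : sigmaPair L (x + s / 2) (s / 2)
      = -(sigma L.lattice (x + s) * sigma L.lattice x) := by
    rw [sigmaPair_swap, sigmaPair]; congr 3 <;> ring
  rw [threeTerm, e, e, e, e', e', e'] at h
  linear_combination -h

/-! ### Denominators and the elliptic net -/

/-- Every lattice in `ℂ` is spanned by a pair of periods. -/
lemma exists_periodPair (Λ : Submodule ℤ ℂ) [DiscreteTopology Λ] [IsZLattice ℝ Λ] :
    ∃ L : PeriodPair, L.lattice = Λ := by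
  have := ZLattice.module_free ℝ Λ
  have := ZLattice.module_finite ℝ Λ
  have hr : Module.finrank ℤ Λ = 2 := by rw [ZLattice.rank ℝ Λ, Complex.finrank_real_complex]
  let b := Module.finBasisOfFinrankEq ℤ Λ hr
  let B := b.ofZLatticeBasis ℝ Λ
  have hB : (B : Fin 2 → ℂ) = ![B 0, B 1] := by ext i; fin_cases i <;> rfl
  refine ⟨⟨B 0, B 1, hB ▸ B.linearIndependent⟩, ?_⟩
  rw [← b.ofZLatticeBasis_span ℝ Λ, PeriodPair.lattice]
  change Submodule.span ℤ {B 0, B 1} = Submodule.span ℤ (Set.range (B : Fin 2 → ℂ))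
  rw [hB]
  simp [Set.pair_comm]

/-- The denominator of `Ω_v`, as a function of `v`. -/
def netDenom (Λ : Submodule ℤ ℂ) {n : ℕ} (z : Fin n → ℂ) (v : Fin n → ℤ) : ℂ :=
  (∏ i, sigma Λ (z i) ^ (2 * v i ^ 2 - ∑ j, v i * v j)) *
    ∏ i, ∏ j ∈ Finset.Ioi i, sigma Λ (z i + z j) ^ (v i * v j)

/-- The exponents in the denominator are quadratic forms in `v`, so the product of the four
denominators is the same in each term of the recurrence. -/
lemma netDenom_cycle (Λ : Submodule ℤ ℂ) {n : ℕ} {z : Fin n → ℂ}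
    (hz : ∀ i, sigma Λ (z i) ≠ 0) (hzz : ∀ i j, i < j → sigma Λ (z i + z j) ≠ 0)
    (p q r s : Fin n → ℤ) :
    netDenom Λ z (p + q + s) * netDenom Λ z (p - q) * netDenom Λ z (r + s) * netDenom Λ z r =
      netDenom Λ z (q + r + s) * netDenom Λ z (q - r) * netDenom Λ z (p + s) * netDenom Λ z p := by
  let A (v : Fin n → ℤ) : ℂ := ∏ i, sigma Λ (z i) ^ (2 * v i ^ 2 - ∑ j, v i * v j)
  let B (v : Fin n → ℤ) : ℂ := ∏ i, ∏ j ∈ Finset.Ioi i, sigma Λ (z i + z j) ^ (v i * v j)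
  have aux (f g : (Fin n → ℤ) → ℂ) (a b c d : Fin n → ℤ) :
      f a * g a * (f b * g b) * (f c * g c) * (f d * g d) =
        f a * f b * f c * f d * (g a * g b * g c * g d) := by ring
  refine (aux A B _ _ _ _).trans (.trans (congrArg₂ (· * ·) ?_ ?_) (aux A B _ _ _ _).symm)
  · simp only [A, ← Finset.prod_mul_distrib]
    refine Finset.prod_congr rfl fun i _ => ?_
    simp only [← zpow_add₀ (hz i), ← Finset.mul_sum, Pi.add_apply, Pi.sub_apply,
      Finset.sum_add_distrib, Finset.sum_sub_distrib]
    congr 1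
    ring
  · simp only [B, ← Finset.prod_mul_distrib]
    refine Finset.prod_congr rfl fun i _ => Finset.prod_congr rfl fun j hj => ?_
    simp only [← zpow_add₀ (hzz i j (Finset.mem_Ioi.mp hj)), Pi.add_apply, Pi.sub_apply]
    congr 1
    ring

end ComplexEllipticNet

end

theorem mainTheorem6 (Λ : Submodule ℤ ℂ) [DiscreteTopology Λ] [IsZLattice ℝ Λ]
    (n : ℕ) (z : Fin n → ℂ)
    (hz : ∀ i, z i ∉ Λ) (hzz : ∀ i j, i < j → z i + z j ∉ Λ) :
    ComplexEllipticNet.IsNet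
      (fun v : Fin n → ℤ => ComplexEllipticNet.Omega Λ v z) := by
  open ComplexEllipticNet in
  obtain ⟨L, rfl⟩ := exists_periodPair Λ
  have hz' (i) : sigma L.lattice (z i) ≠ 0 := sigma_ne_zero L (hz i)
  have hzz' (i j) (h : i < j) : sigma L.lattice (z i + z j) ≠ 0 := sigma_ne_zero L (hzz i j h)
  refine ⟨Omega_zero _ z, fun p q r s => ?_⟩
  have hΩ (v : Fin n → ℤ) : Omega L.lattice v z =
    sigma L.lattice (∑ i, (v i : ℂ) * z i) / netDenom L.lattice z v := rfl
  have hadd (v w : Fin n → ℤ) : ∑ i, ((v + w) i : ℂ) * z i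
      = ∑ i, (v i : ℂ) * z i + ∑ i, (w i : ℂ) * z i := by
    simp [add_mul, Finset.sum_add_distrib]
  have hsub (v w : Fin n → ℤ) : ∑ i, ((v - w) i : ℂ) * z i
      = ∑ i, (v i : ℂ) * z i - ∑ i, (w i : ℂ) * z i := by
    simp [sub_mul, Finset.sum_sub_distrib]
  have h1 := netDenom_cycle L.lattice hz' hzz' p q r s
  have h2 := netDenom_cycle L.lattice hz' hzz' q r p s
  simp only [hΩ, hadd, hsub, div_mul_div_comm]
  rw [← h2, ← h1, ← add_div, ← add_div, sigma_net, zero_div]
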